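/- Average output SNR of shadowing-based UAV selection under double shadowing. Let $L\ge 1$, $m_1,m_2>0$, $\Omega>0$, $\overline\gamma_1,\overline\gamma_2>0$, $\alpha_1>1$ with $2\alpha_1\in\mathbb N$, and $\alpha_2=\alpha_1+\tfrac12$. For $1\le i\le L$ and $j\in\{1,2\}$ let $N_{i,j}$ and $I_{i,j}$ be $4L$ mutually independent random variables such that $N_{i,j}^2$ has density $\frac{m_j^{m_j}x^{m_j-1}}{\Omega^{m_j}\Gamma(m_j)}e^{-m_jx/\Omega}$, $x>0$ (the square of a Nakagami-$m_j$ variable with mean square $\Omega$), and $I_{i,j}$ has the inverse gamma density $\frac{\overline\gamma_j^{\alpha_j}}{\Gamma(\alpha_j)y^{\alpha_j+1}}e^{-\overline\gamma_j/y}$, $y>0$. Put $N_i=(N_{i,1}N_{i,2})^2$, $I_i=I_{i,1}I_{i,2}$, $\overline\gamma=\Omega^2\,\overline\gamma_1\overline\gamma_2$ (so $\overline\gamma=\overline\gamma_1\overline\gamma_2$ in the normalization $\Omega=1$), and let $\gamma_{\rm out}=N_{i^*}\max_{1\le i\le L}I_i$, where $i^*$ is a (random, measurable) index with $I_{i^*}=\max_{1\le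 i\le L} I_i$ almost surely. Then $\gamma_{\rm out}$ is integrable and has a density $f_{\gamma_{\rm out}}$, and its mean $\overline\gamma_{\rm out}=\mathbb E[\gamma_{\rm out}]=\int_0^\infty x f_{\gamma_{\rm out}}(x)\,dx$ (a convergent integral) is $$\overline\gamma_{\rm out}=\frac{L}{\Gamma(\alpha_1)\Gamma(\alpha_2)}\sum_{i_1=0}^{L-1}\sum_{i_2=0}^{i_1}\binom{L-1}{i_1}\binom{i_1}{i_2}\sum_{\substack{n_0,\dots,n_{2\alpha_1-1}\ge 0\\ n_0+\cdots+n_{2\alpha_1-1}=i_2}}\frac{\mathcal A\,\overline\gamma\,2^{7/2-q}\sqrt\pi\,\Gamma(q-5/2)}{(i_2+1)^{q-5/2}},$$ where $\mathcal A=\frac{i_2!}{n_0!\,n_1!\cdots n_{2\alpha_1-1}!}\prod_{j=1}^{2\alpha_1-1}\left(\frac{2^j}{j!}\right)^{n_j}(-1)^{i_1+i_2}$ and $q=\alpha_1+\alpha_2+\sum_{j=1}^{2\alpha_1-1}j\,n_j$. In particular $\overline\gamma_{\rm out}$ does not depend on the Nakagami parameters $m_1,m_2$: two such systems, possibly on different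 probability spaces, with the same $L,\Omega,\alpha_1,\alpha_2,\overline\gamma_1,\overline\gamma_2$ but different $m_1,m_2$ have the same average output SNR. -/

import Mathlib

open MeasureTheory ProbabilityTheory Set
open scoped BigOperators Nat

noncomputable section

namespace UAVSelection

/-- Density of the inverse gamma distribution with shape `a` and scale `b`. -/
def invGammaPDFReal (a b y : ℝ) : ℝ :=
  if 0 < y then b ^ a / (Real.Gamma a * y ^ (a + 1)) * Real.exp (-(b / y)) else 0

/-- The inverse gamma distribution with shape `a` and scale `b`. -/
def invGammaMeasure (a b : ℝ) : Measure ℝ :=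
  volume.withDensity (fun y => ENNReal.ofReal (invGammaPDFReal a b y))

/-- The double-shadowing channel with `L` UAVs and two scattering regions (indexed by `Fin 2`).
`N i j` is the multipath fading coefficient and `S i j` the shadowing coefficient of the `j`-th
region of the `i`-th UAV. All these variables are independent. The square `(N i j) ^ 2` of a
Nakagami variable with shape `m j` and mean square `Ω` has the gamma law with shape `m j` and rate
`m j / Ω`, and `S i j` has the inverse gamma law with shape `α j` and scale `γ j`. -/
structure IsDoubleShadowing {W : Type*} [MeasurableSpace W] (P : Measure W) (L : ℕ)
    (m : Fin 2 → ℝ) (Ω : ℝ) (α γ : Fin 2 → ℝ) (N S : Fin L → Fin 2 → W → ℝ) : Prop where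
  measurable_fading : ∀ i j, Measurable (N i j)
  measurable_shadowing : ∀ i j, Measurable (S i j)
  law_fading : ∀ i j, HasLaw (fun w => N i j w ^ 2) (gammaMeasure (m j) (m j / Ω)) P
  law_shadowing : ∀ i j, HasLaw (S i j) (invGammaMeasure (α j) (γ j)) P
  indep : iIndepFun
    (Sum.elim (fun p : Fin L × Fin 2 => N p.1 p.2) (fun p : Fin L × Fin 2 => S p.1 p.2)) P

/-- Total multipath fading `N_i = (N_{i,1} N_{i,2})²` of the `i`-th UAV. -/
def totalFading {W : Type*} {L : ℕ} (N : Fin L → Fin 2 → W → ℝ) (i : Fin L) (w : W) : ℝ :=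
  (N i 0 w * N i 1 w) ^ 2

/-- Total shadowing `I_i = I_{i,1} I_{i,2}` of the `i`-th UAV. -/
def totalShadowing {W : Type*} {L : ℕ} (S : Fin L → Fin 2 → W → ℝ) (i : Fin L) (w : W) : ℝ :=
  S i 0 w * S i 1 w

/-- `sel` is (the index of) a UAV whose total shadowing variable is the largest one. -/
structure IsShadowingSelection {W : Type*} [MeasurableSpace W] (P : Measure W) {L : ℕ}
    (S : Fin L → Fin 2 → W → ℝ) (sel : W → Fin L) : Prop where
  measurable_sel : Measurable sel
  maximal : ∀ᵐ w ∂P, ∀ i, totalShadowing S i w ≤ totalShadowing S (sel w) w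

/-- Output SNR: the multipath fading of the selected UAV times the largest shadowing variable. -/
def outputSNR {W : Type*} {L : ℕ} (N S : Fin L → Fin 2 → W → ℝ) (sel : W → Fin L) (w : W) : ℝ :=
  totalFading N (sel w) w * ⨆ i, totalShadowing S i w

/-- Average SNR `∫₀^∞ x f_X(x) dx` of a random variable `X` with density `f_X`. -/
def averageSNR {W : Type*} [MeasurableSpace W] (P : Measure W) (X : W → ℝ) : ℝ :=
  ∫ x in Ioi (0 : ℝ), x * (pdf X P volume x).toReal

/-- The coefficient `𝒜`; here `k` is the number of the summation indices `n_0, …, n_{k-1}`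
(the factor with `j = 0` is equal to `1`). -/
def coeffA {k : ℕ} (i₁ i₂ : ℕ) (n : Fin k → ℕ) : ℝ :=
  (i₂ ! : ℝ) / (∏ j, ((n j)! : ℝ)) *
    (∏ j : Fin k, ((2 : ℝ) ^ (j : ℕ) / ((j : ℕ)! : ℝ)) ^ n j) * (-1) ^ (i₁ + i₂)

/-- The exponent `q = α₁ + α₂ + ∑ j n_j`. -/
def expoQ {k : ℕ} (α : Fin 2 → ℝ) (n : Fin k → ℕ) : ℝ :=
  α 0 + α 1 + ∑ j : Fin k, ((j : ℕ) : ℝ) * (n j : ℝ)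

/-- The closed form of the average output SNR. The inner sum is over all
`(n_0, …, n_{k-1})` in `{0, …, i₂}^k` with `n_0 + ⋯ + n_{k-1} = i₂`. -/
def closedFormASNR (L k : ℕ) (α : Fin 2 → ℝ) (gbar : ℝ) : ℝ :=
  (L : ℝ) / (Real.Gamma (α 0) * Real.Gamma (α 1)) *
    ∑ i₁ ∈ Finset.range L, ∑ i₂ ∈ Finset.range (i₁ + 1),
      ((L - 1).choose i₁ : ℝ) * (i₁.choose i₂ : ℝ) *
        ∑ n ∈ (Finset.univ : Finset (Fin k)).piAntidiag i₂,
          coeffA i₁ i₂ n * gbar * (2 : ℝ) ^ (7 / 2 - expoQ α n) * √Real.pi *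
            Real.Gamma (expoQ α n - 5 / 2) / ((i₂ : ℝ) + 1) ^ (expoQ α n - 5 / 2)

end UAVSelection

end

/-!
The inverse of an inverse gamma variable is a gamma variable. By Legendre's duplication formula,
`2 √(X Y)` has the gamma law with shape `2 a` and rate `√(r s)` whenever `X` and `Y` are independent
gamma variables with shapes `a`, `a + 1/2` and rates `r`, `s`: both laws have the same Mellin
transform on the imaginary axis, that is, their logarithms have the same characteristic function.
Hence `U_i = 2 / √I_i` has the gamma law with integer shape `k = 2 α₁` and rate
`ρ = √(γ₁ γ₂)`, an Erlang law, whose survival function is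
`G u = exp (-ρ u) ∑_{j < k} (ρ u) ^ j / j!`.

The largest `I_i = 4 / U_i ^ 2` belongs to the smallest `U_i`, which is almost surely unique, so the
selection is almost surely determined by the shadowing. It is therefore independent of the fading,
whose mean is `Ω ^ 2`, and the average output SNR is `Ω ^ 2 * L * 𝔼[4 U⁻² G(U) ^ (L - 1)]`. The
stated sum arises by expanding `G ^ (L - 1) = (1 - (1 - G)) ^ (L - 1)` binomially, once more for the
powers of `1 - G`, and the powers of `G` by the multinomial theorem; each term is then a Gamma
integral.
-/

namespace UAVSelection

theorem ae_of_hasLaw {W E : Type*} [MeasurableSpace W] [MeasurableSpace E] {P : Measure W}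
    {X : W → E} {μ : Measure E} (hX : HasLaw X μ P) {p : E → Prop} (hp : ∀ᵐ x ∂μ, p x) :
    ∀ᵐ w ∂P, p (X w) :=
  ae_of_ae_map hX.aemeasurable (hX.map_eq.symm ▸ hp)

section GammaLaws

variable {a r : ℝ}

theorem gammaMeasure_eq_withDensity_restrict (a r : ℝ) :
    gammaMeasure a r = (volume.restrict (Ioi 0)).withDensity fun x =>
      ENNReal.ofReal (r ^ a / Real.Gamma a * x ^ (a - 1) * Real.exp (-(r * x))) := by
  rw [gammaMeasure, ← withDensity_indicator measurableSet_Ioi]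
  refine withDensity_congr_ae ?_
  filter_upwards [Measure.ae_ne volume 0] with x hx
  rcases hx.lt_or_gt with hneg | hpos
  · rw [gammaPDF_of_neg hneg, indicator_of_notMem (notMem_Ioi.2 hneg.le)]
  · rw [gammaPDF_of_nonneg hpos.le, indicator_of_mem (mem_Ioi.2 hpos)]

theorem invGammaMeasure_eq_withDensity_restrict (a b : ℝ) :
    invGammaMeasure a b = (volume.restrict (Ioi 0)).withDensity fun y =>
      ENNReal.ofReal (b ^ a / (Real.Gamma a * y ^ (a + 1)) * Real.exp (-(b / y))) := by
  rw [invGammaMeasure, ← withDensity_indicator measurableSet_Ioi]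
  congr 1 with y
  by_cases hy : 0 < y <;> simp [invGammaPDFReal, hy]

theorem ae_pos_gammaMeasure (a r : ℝ) : ∀ᵐ x ∂gammaMeasure a r, 0 < x := by
  rw [gammaMeasure_eq_withDensity_restrict]
  exact (withDensity_absolutelyContinuous _ _).ae_le (ae_restrict_mem measurableSet_Ioi)

theorem ae_pos_invGammaMeasure (a b : ℝ) : ∀ᵐ y ∂invGammaMeasure a b, 0 < y := by
  rw [invGammaMeasure_eq_withDensity_restrict]
  exact (withDensity_absolutelyContinuous _ _).ae_le (ae_restrict_mem measurableSet_Ioi)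

theorem map_inv_invGammaMeasure (a b : ℝ) :
    (invGammaMeasure a b).map (·⁻¹) = gammaMeasure a b := by
  have himage : (·⁻¹) '' Ioi (0 : ℝ) = Ioi 0 := by ext; simp
  have hderiv : ∀ y ∈ Ioi (0 : ℝ), HasDerivWithinAt (·⁻¹) (-(y ^ 2)⁻¹) (Ioi 0) y := fun y hy =>
    (hasDerivAt_inv (ne_of_gt hy)).hasDerivWithinAt
  ext A hA
  rw [Measure.map_apply measurable_inv hA, invGammaMeasure_eq_withDensity_restrict,
    gammaMeasure_eq_withDensity_restrict, withDensity_apply _ hA,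
    withDensity_apply _ (measurable_inv hA), ← lintegral_indicator hA,
    ← lintegral_indicator (measurable_inv hA)]
  conv_rhs => rw [← himage]
  rw [lintegral_image_eq_lintegral_abs_deriv_mul measurableSet_Ioi hderiv inv_injective.injOn]
  refine setLIntegral_congr_fun measurableSet_Ioi fun y (hy : 0 < y) => ?_
  by_cases hyA : y⁻¹ ∈ A
  · rw [indicator_of_mem hyA, indicator_of_mem (by exact hyA), abs_neg,
      abs_of_nonneg (by positivity), ← ENNReal.ofReal_mul (by positivity), Real.inv_rpow hy.le,
      show a + 1 = a - 1 + 2 by ring, Real.rpow_add hy, Real.rpow_two]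
    congr 1
    simp only [div_eq_mul_inv, mul_inv]
    ring
  · rw [indicator_of_notMem hyA, indicator_of_notMem (by exact hyA), mul_zero]

theorem integral_gammaMeasure {E : Type*} [NormedAddCommGroup E] [NormedSpace ℝ E]
    (ha : 0 < a) (hr : 0 < r) (f : ℝ → E) :
    ∫ x, f x ∂gammaMeasure a r =
      ∫ x in Ioi 0, (r ^ a / Real.Gamma a * x ^ (a - 1) * Real.exp (-(r * x))) • f x := by
  rw [gammaMeasure_eq_withDensity_restrict,
    integral_withDensity_eq_integral_toReal_smul (by fun_prop) (by simp)]
  refine setIntegral_congr_fun measurableSet_Ioi fun x (hx : 0 < x) => ?_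
  rw [ENNReal.toReal_ofReal (by positivity)]

theorem integrable_gammaMeasure_iff {E : Type*} [NormedAddCommGroup E] [NormedSpace ℝ E]
    (ha : 0 < a) (hr : 0 < r) (f : ℝ → E) :
    Integrable f (gammaMeasure a r) ↔ IntegrableOn
      (fun x => (r ^ a / Real.Gamma a * x ^ (a - 1) * Real.exp (-(r * x))) • f x) (Ioi 0) := by
  rw [gammaMeasure_eq_withDensity_restrict,
    integrable_withDensity_iff_integrable_smul' (by fun_prop) (by simp)]
  refine integrableOn_congr_fun (fun x (hx : 0 < x) => ?_) measurableSet_Ioi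
  rw [ENNReal.toReal_ofReal (by positivity)]

variable {s c : ℝ}

theorem gammaPDF_mul_rpow_mul_exp_eqOn (a r s c : ℝ) :
    EqOn (fun x => (r ^ a / Real.Gamma a * x ^ (a - 1) * Real.exp (-(r * x))) •
        (x ^ s * Real.exp (-(c * x))))
      (fun x => r ^ a / Real.Gamma a * (x ^ (a + s - 1) * Real.exp (-((r + c) * x))))
      (Ioi 0) := by
  intro x (hx : 0 < x)
  simp only [smul_eq_mul]
  rw [show a + s - 1 = a - 1 + s by ring, Real.rpow_add hx,
    show -((r + c) * x) = -(r * x) + -(c * x) by ring, Real.exp_add]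
  ring

theorem integrable_rpow_mul_exp_neg_mul_gammaMeasure (ha : 0 < a) (hr : 0 < r)
    (has : 0 < a + s) (hrc : 0 < r + c) :
    Integrable (fun x => x ^ s * Real.exp (-(c * x))) (gammaMeasure a r) := by
  rw [integrable_gammaMeasure_iff ha hr,
    integrableOn_congr_fun (gammaPDF_mul_rpow_mul_exp_eqOn a r s c) measurableSet_Ioi]
  have hint := integrableOn_rpow_mul_exp_neg_mul_rpow (s := a + s - 1) (by linarith) one_pos hrc
  simp only [Real.rpow_one, neg_mul] at hint
  exact hint.const_mul _

theorem integral_rpow_mul_exp_neg_mul_gammaMeasure (ha : 0 < a) (hr : 0 < r)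
    (has : 0 < a + s) (hrc : 0 < r + c) :
    ∫ x, x ^ s * Real.exp (-(c * x)) ∂gammaMeasure a r =
      r ^ a * Real.Gamma (a + s) / (Real.Gamma a * (r + c) ^ (a + s)) := by
  rw [integral_gammaMeasure ha hr,
    setIntegral_congr_fun measurableSet_Ioi (gammaPDF_mul_rpow_mul_exp_eqOn a r s c),
    integral_const_mul, Real.integral_rpow_mul_exp_neg_mul_Ioi has hrc, one_div,
    Real.inv_rpow hrc.le]
  field_simp

theorem integrable_rpow_gammaMeasure (ha : 0 < a) (hr : 0 < r) (has : 0 < a + s) :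
    Integrable (fun x => x ^ s) (gammaMeasure a r) := by
  simpa using integrable_rpow_mul_exp_neg_mul_gammaMeasure (c := 0) ha hr has (by simpa)

theorem integrable_id_gammaMeasure (ha : 0 < a) (hr : 0 < r) :
    Integrable id (gammaMeasure a r) := by
  simpa [Function.id_def] using integrable_rpow_gammaMeasure (s := 1) ha hr (by linarith)

theorem integral_id_gammaMeasure (ha : 0 < a) (hr : 0 < r) :
    ∫ x, x ∂gammaMeasure a r = a / r := by
  have hmean := integral_rpow_mul_exp_neg_mul_gammaMeasure (s := 1) (c := 0) ha hr
    (by linarith) (by simpa)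
  have hΓ := (Real.Gamma_pos_of_pos ha).ne'
  simp only [Real.rpow_one, zero_mul, neg_zero, Real.exp_zero, mul_one, add_zero] at hmean
  rw [hmean, Real.Gamma_add_one ha.ne', Real.rpow_add_one hr.ne']
  field_simp

theorem integral_cpow_gammaMeasure (ha : 0 < a) (hr : 0 < r) {z : ℂ} (hz : 0 < a + z.re) :
    ∫ x, (x : ℂ) ^ z ∂gammaMeasure a r =
      (r : ℂ) ^ (-z) * Complex.Gamma (a + z) / Real.Gamma a := by
  have hr' : (r : ℂ) ≠ 0 := by exact_mod_cast hr.ne'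
  have hra : ((r : ℂ) ^ (a : ℂ)) ≠ 0 := by simp [Complex.cpow_eq_zero_iff, hr']
  have hintegrand : EqOn
      (fun x : ℝ => (r ^ a / Real.Gamma a * x ^ (a - 1) * Real.exp (-(r * x))) • (x : ℂ) ^ z)
      (fun x => (r : ℂ) ^ (a : ℂ) / Real.Gamma a *
        ((x : ℂ) ^ ((a + z : ℂ) - 1) * Complex.exp (-(r * x)))) (Ioi 0) := by
    intro x (hx : 0 < x)
    have hx' : (x : ℂ) ≠ 0 := by exact_mod_cast hx.ne'
    simp only [Complex.real_smul]
    rw [show (a : ℂ) + z - 1 = ((a - 1 : ℝ) : ℂ) + z by push_cast; ring,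
      Complex.cpow_add _ _ hx', ← Complex.ofReal_cpow hx.le, ← Complex.ofReal_cpow hr.le]
    push_cast
    ring
  rw [integral_gammaMeasure ha hr, setIntegral_congr_fun measurableSet_Ioi hintegrand,
    integral_const_mul, Complex.integral_cpow_mul_exp_neg_mul_Ioi (by simpa using hz) hr,
    one_div, ← Complex.ofReal_inv, Complex.ofReal_inv, Complex.inv_cpow _ _ (by
      rw [Complex.arg_ofReal_of_nonneg hr.le]; exact Real.pi_pos.ne), Complex.cpow_add _ _ hr',
    Complex.cpow_neg]
  field_simp

end GammaLaws

section Mellin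

open Complex (I)

theorem ext_of_integral_cpow_mul_I {μ ν : Measure ℝ} [IsFiniteMeasure μ] [IsFiniteMeasure ν]
    (hμ : ∀ᵐ x ∂μ, 0 < x) (hν : ∀ᵐ x ∂ν, 0 < x)
    (h : ∀ t : ℝ, ∫ x, (x : ℂ) ^ (t * I) ∂μ = ∫ x, (x : ℂ) ^ (t * I) ∂ν) : μ = ν := by
  have charFun_map_log : ∀ {ρ : Measure ℝ}, (∀ᵐ x ∂ρ, 0 < x) → ∀ t,
      charFun (ρ.map Real.log) t = ∫ x, (x : ℂ) ^ (t * I) ∂ρ := fun hρ t => by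
    rw [charFun_apply_real, integral_map (by fun_prop) (by fun_prop)]
    refine integral_congr_ae ?_
    filter_upwards [hρ] with x hx
    rw [Complex.cpow_def_of_ne_zero (by exact_mod_cast hx.ne'), ← Complex.ofReal_log hx.le]
    congr 1
    ring
  have map_exp_map_log : ∀ {ρ : Measure ℝ}, (∀ᵐ x ∂ρ, 0 < x) →
      (ρ.map Real.log).map Real.exp = ρ := fun {ρ} hρ => by
    rw [Measure.map_map (by fun_prop) (by fun_prop)]
    refine (Measure.map_congr ?_).trans Measure.map_id
    filter_upwards [hρ] with x hx using Real.exp_log hx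
  rw [← map_exp_map_log hμ, ← map_exp_map_log hν]
  congr 1
  refine Measure.ext_of_charFun (funext fun t => ?_)
  rw [charFun_map_log hμ, charFun_map_log hν, h]

theorem ofReal_sqrt_mul_cpow {x y : ℝ} (hx : 0 < x) (hy : 0 < y) (z : ℂ) :
    ((√(x * y) : ℝ) : ℂ) ^ z = (x : ℂ) ^ (z / 2) * (y : ℂ) ^ (z / 2) := by
  have hxy : √(x * y) ≠ 0 := (Real.sqrt_pos.2 (mul_pos hx hy)).ne'
  rw [Complex.cpow_def_of_ne_zero (by exact_mod_cast hxy),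
    Complex.cpow_def_of_ne_zero (by exact_mod_cast hx.ne'),
    Complex.cpow_def_of_ne_zero (by exact_mod_cast hy.ne'), ← Complex.exp_add,
    ← Complex.ofReal_log (Real.sqrt_nonneg _), ← Complex.ofReal_log hx.le,
    ← Complex.ofReal_log hy.le, Real.log_sqrt (by positivity), Real.log_mul hx.ne' hy.ne']
  congr 1
  push_cast
  ring

theorem two_cpow_mul_Gamma_mul_Gamma_add_half_div {a : ℝ} (ha : 0 < a) (z : ℂ) :
    (2 : ℂ) ^ z * (Complex.Gamma (a + z / 2) * Complex.Gamma (a + 1 / 2 + z / 2)) /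
        (Real.Gamma a * Real.Gamma (a + 1 / 2)) =
      Complex.Gamma (2 * a + z) / Real.Gamma (2 * a) := by
  have hΓ : (Complex.Gamma (2 * a)) ≠ 0 := by
    have := (Real.Gamma_pos_of_pos (mul_pos two_pos ha)).ne'
    rwa [← Complex.ofReal_ne_zero, ← Complex.Gamma_ofReal, Complex.ofReal_mul] at this
  have hpow : (2 : ℂ) ^ (1 - 2 * (a : ℂ)) ≠ 0 := by simp [Complex.cpow_eq_zero_iff]
  have hpow' : (2 : ℂ) ^ z ≠ 0 := by simp [Complex.cpow_eq_zero_iff]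
  have hπ : ((√Real.pi : ℝ) : ℂ) ≠ 0 := by exact_mod_cast (Real.sqrt_pos.2 Real.pi_pos).ne'
  have hnum := Complex.Gamma_mul_Gamma_add_half (a + z / 2)
  rw [show (a : ℂ) + z / 2 + 1 / 2 = a + 1 / 2 + z / 2 by ring,
    show 2 * ((a : ℂ) + z / 2) = 2 * a + z by ring,
    show 1 - (2 * (a : ℂ) + z) = 1 - 2 * a - z by ring, Complex.cpow_sub _ _ two_ne_zero] at hnum
  have hden := Complex.Gamma_mul_Gamma_add_half a
  simp only [← Complex.Gamma_ofReal]
  push_cast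
  rw [hnum, hden]
  field_simp

section Duplication

variable {W : Type*} [MeasurableSpace W] {P : Measure W} {X Y : W → ℝ} {a r s : ℝ}

theorem integral_two_mul_sqrt_mul_cpow {μ ν : Measure ℝ} (hX : HasLaw X μ P) (hY : HasLaw Y ν P)
    (hμ : ∀ᵐ x ∂μ, 0 < x) (hν : ∀ᵐ y ∂ν, 0 < y) (hXY : IndepFun X Y P) (z : ℂ) :
    ∫ w, ((2 * √(X w * Y w) : ℝ) : ℂ) ^ z ∂P =
      2 ^ z * ((∫ x, (x : ℂ) ^ (z / 2) ∂μ) * ∫ y, (y : ℂ) ^ (z / 2) ∂ν) := by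
  have hmeas : Measurable fun x : ℝ => (x : ℂ) ^ (z / 2) := by fun_prop
  rw [← hX.integral_comp hmeas.aestronglyMeasurable, ← hY.integral_comp hmeas.aestronglyMeasurable,
    ← hXY.integral_comp_mul_comp hX.aemeasurable hY.aemeasurable hmeas.aestronglyMeasurable
      hmeas.aestronglyMeasurable, ← integral_const_mul]
  refine integral_congr_ae ?_
  filter_upwards [ae_of_hasLaw hX hμ, ae_of_hasLaw hY hν] with w hx hy
  rw [Complex.ofReal_mul, Complex.mul_cpow_ofReal_nonneg zero_le_two (Real.sqrt_nonneg _),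
    ofReal_sqrt_mul_cpow hx hy]
  rfl

theorem hasLaw_two_mul_sqrt_mul (ha : 0 < a) (hr : 0 < r) (hs : 0 < s)
    (hX : HasLaw X (gammaMeasure a r) P) (hY : HasLaw Y (gammaMeasure (a + 1 / 2) s) P)
    (hXY : IndepFun X Y P) :
    HasLaw (fun w => 2 * √(X w * Y w)) (gammaMeasure (2 * a) √(r * s)) P := by
  have := isProbabilityMeasure_gammaMeasure ha hr
  have := hX.isProbabilityMeasure
  have := isProbabilityMeasure_gammaMeasure (mul_pos two_pos ha)
    (Real.sqrt_pos.2 (mul_pos hr hs))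
  have hXm := hX.aemeasurable
  have hYm := hY.aemeasurable
  refine ⟨by fun_prop, ext_of_integral_cpow_mul_I ?_ (ae_pos_gammaMeasure _ _) fun t => ?_⟩
  · rw [ae_map_iff (by fun_prop) measurableSet_Ioi]
    filter_upwards [ae_of_hasLaw hX (ae_pos_gammaMeasure _ _),
      ae_of_hasLaw hY (ae_pos_gammaMeasure _ _)] with w hx hy
    positivity
  have hre : ((t * I : ℂ) / 2).re = 0 := by simp
  have hmeas : Measurable fun x : ℝ => (x : ℂ) ^ (t * I) := by fun_prop
  rw [integral_map (by fun_prop) hmeas.aestronglyMeasurable,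
    integral_two_mul_sqrt_mul_cpow hX hY (ae_pos_gammaMeasure _ _) (ae_pos_gammaMeasure _ _) hXY,
    integral_cpow_gammaMeasure ha hr (by rw [hre]; linarith),
    integral_cpow_gammaMeasure (by linarith) hs (by rw [hre]; linarith),
    integral_cpow_gammaMeasure (by linarith) (by positivity) (by simpa),
    ofReal_sqrt_mul_cpow hr hs, neg_div]
  push_cast
  linear_combination (r : ℂ) ^ (-(t * I / 2)) * (s : ℂ) ^ (-(t * I / 2)) *
    two_cpow_mul_Gamma_mul_Gamma_add_half_div ha (t * I)

end Duplication

end Mellin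

section Erlang

/-- The Taylor polynomial `∑_{j < k} x ^ j / j!` of the exponential function. It is indexed by its
number of terms, which is the shape of the Erlang law whose survival function it describes. -/
noncomputable def truncExp (k : ℕ) (x : ℝ) : ℝ :=
  ∑ j ∈ Finset.range k, x ^ j / (j ! : ℝ)

theorem hasDerivAt_truncExp_succ (k : ℕ) (x : ℝ) :
    HasDerivAt (truncExp (k + 1)) (truncExp k x) x := by
  have hterm : ∀ j ∈ Finset.range k,
      HasDerivAt (fun x : ℝ => x ^ (j + 1) / ((j + 1)! : ℝ)) (x ^ j / (j ! : ℝ)) x := by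
    intro j _
    convert! (hasDerivAt_pow (j + 1) x).div_const ((j + 1)! : ℝ) using 1
    rw [Nat.factorial_succ]
    push_cast
    field_simp
  convert! (HasDerivAt.fun_sum hterm).add_const 1 using 1
  ext x
  simp [truncExp, Finset.sum_range_succ']

theorem hasDerivAt_exp_neg_mul_truncExp (k : ℕ) (x : ℝ) :
    HasDerivAt (fun x => Real.exp (-x) * truncExp (k + 1) x)
      (-(Real.exp (-x) * (x ^ k / (k ! : ℝ)))) x := by
  convert! (hasDerivAt_neg x).exp.mul (hasDerivAt_truncExp_succ k x) using 1
  rw [truncExp, Finset.sum_range_succ, truncExp]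
  ring

theorem tendsto_exp_neg_mul_truncExp (k : ℕ) :
    Filter.Tendsto (fun x => Real.exp (-x) * truncExp k x) Filter.atTop (nhds 0) := by
  have hsum := tendsto_finsetSum (Finset.range k) fun j _ =>
    (Real.tendsto_pow_mul_exp_neg_atTop_nhds_zero j).div_const (j ! : ℝ)
  simp only [zero_div, Finset.sum_const_zero] at hsum
  refine hsum.congr fun x => ?_
  rw [truncExp, Finset.mul_sum]
  exact Finset.sum_congr rfl fun j _ => by ring

theorem gammaMeasure_real_Ici {k : ℕ} (hk : 0 < k) {r u : ℝ} (hr : 0 < r) (hu : 0 ≤ u) :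
    (gammaMeasure k r).real (Ici u) = Real.exp (-(r * u)) * truncExp k (r * u) := by
  obtain ⟨k, rfl⟩ := Nat.exists_eq_add_one.2 hk
  have hshape : (0 : ℝ) < (k + 1 : ℕ) := by positivity
  have := isProbabilityMeasure_gammaMeasure hshape hr
  let density : ℝ → ℝ := fun x => r ^ ((k + 1 : ℕ) : ℝ) / Real.Gamma (k + 1 : ℕ) *
    x ^ (((k + 1 : ℕ) : ℝ) - 1) * Real.exp (-(r * x))
  have hderiv : ∀ x, HasDerivAt (fun x => -(Real.exp (-(r * x)) * truncExp (k + 1) (r * x)))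
      (density x) x := by
    intro x
    convert! ((hasDerivAt_exp_neg_mul_truncExp k (r * x)).comp x
      ((hasDerivAt_id x).const_mul r)).neg using 1
    simp only [density, Nat.cast_add, Nat.cast_one, add_sub_cancel_right,
      Real.Gamma_nat_eq_factorial, Real.rpow_natCast]
    rw [Real.rpow_add_one hr.ne', Real.rpow_natCast]
    ring
  have hlim : Filter.Tendsto (fun x => -(Real.exp (-(r * x)) * truncExp (k + 1) (r * x)))
      Filter.atTop (nhds 0) := by
    simpa using ((tendsto_exp_neg_mul_truncExp (k + 1)).comp
      (Filter.tendsto_id.const_mul_atTop hr)).neg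
  have hint : IntegrableOn density (Ioi 0) := by
    simpa [density] using
      (integrable_gammaMeasure_iff hshape hr _).1 (integrable_const (1 : ℝ))
  calc (gammaMeasure (k + 1 : ℕ) r).real (Ici u)
      = ∫ x in Ioi 0, (Ici u).indicator density x := by
        rw [← integral_indicator_one measurableSet_Ici, integral_gammaMeasure hshape hr]
        simp only [indicator, Pi.one_apply, smul_eq_mul, mul_ite, mul_one, mul_zero, density]
    _ = ∫ x in Ioi u, density x := by
        rw [← integral_Ici_eq_integral_Ioi, setIntegral_indicator measurableSet_Ici,
          inter_eq_right.2 (Ici_subset_Ici.2 hu), integral_Ici_eq_integral_Ioi]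
    _ = Real.exp (-(r * u)) * truncExp (k + 1) (r * u) := by
        rw [integral_Ioi_of_hasDerivAt_of_tendsto' (fun x _ => hderiv x)
          (hint.mono_set (Ioi_subset_Ioi hu)) hlim]
        ring

end Erlang

section MinimumMoments

/-- The exponent `∑ j n_j` of the monomial picked out by the multi-index `n` in the expansion of a
power of `truncExp k`. -/
def weight {k : ℕ} (n : Fin k → ℕ) : ℕ :=
  ∑ j : Fin k, (j : ℕ) * n j

/-- The coefficient of the multi-index `n` in the multinomial expansion of a power of
`truncExp k`. -/
noncomputable def truncExpCoeff {k : ℕ} (n : Fin k → ℕ) : ℝ :=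
  Nat.multinomial Finset.univ n * ∏ j : Fin k, (1 / ((j : ℕ)! : ℝ)) ^ n j

theorem prod_pow_mul_eq_pow_weight_mul_prod {k : ℕ} (x : ℝ) (n : Fin k → ℕ) :
    ∏ j : Fin k, (x ^ (j : ℕ) / ((j : ℕ)! : ℝ)) ^ n j =
      x ^ weight n * ∏ j : Fin k, (1 / ((j : ℕ)! : ℝ)) ^ n j := by
  rw [weight, ← Finset.prod_pow_eq_pow_sum, ← Finset.prod_mul_distrib]
  exact Finset.prod_congr rfl fun j _ => by rw [pow_mul, ← mul_pow, mul_one_div]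

theorem truncExp_pow (k i : ℕ) (x : ℝ) :
    truncExp k x ^ i =
      ∑ n ∈ (Finset.univ : Finset (Fin k)).piAntidiag i, truncExpCoeff n * x ^ weight n := by
  rw [truncExp, ← Fin.sum_univ_eq_sum_range fun j => x ^ j / (j ! : ℝ),
    Finset.sum_pow_eq_sum_piAntidiag]
  refine Finset.sum_congr rfl fun n _ => ?_
  rw [prod_pow_mul_eq_pow_weight_mul_prod, truncExpCoeff]
  ring

/-- The expansion of `(1 - (1 - x)) ^ n`, followed by that of the powers of `1 - x`. -/
theorem pow_eq_sum_choose_mul_choose {R : Type*} [CommRing R] (x : R) (n : ℕ) :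
    x ^ n = ∑ i₁ ∈ Finset.range (n + 1), ∑ i₂ ∈ Finset.range (i₁ + 1),
      (n.choose i₁ : R) * (i₁.choose i₂ : R) * ((-1) ^ (i₁ + i₂) * x ^ i₂) := by
  have houter := add_pow (x + -1) 1 n
  rw [neg_add_cancel_right] at houter
  rw [houter]
  refine Finset.sum_congr rfl fun i _ => ?_
  rw [add_pow x (-1) i, one_pow, mul_one, Finset.sum_mul]
  refine Finset.sum_congr rfl fun j hj => ?_
  have hsign : (-1 : R) ^ (i - j) = (-1) ^ (i + j) :=
    neg_one_pow_congr (by have := Finset.mem_range_succ_iff.1 hj; grind)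
  rw [hsign]
  ring

variable {k : ℕ} {r s : ℝ}

theorem rpow_mul_gammaMeasure_real_Ici_pow_ae_eq (hk : 0 < k) (hr : 0 < r) (s : ℝ) (i : ℕ) :
    (fun u => u ^ s * (gammaMeasure k r).real (Ici u) ^ i) =ᵐ[gammaMeasure k r] fun u =>
      ∑ n ∈ (Finset.univ : Finset (Fin k)).piAntidiag i,
        truncExpCoeff n * r ^ weight n * (u ^ (s + weight n) * Real.exp (-(i * r * u))) := by
  filter_upwards [ae_pos_gammaMeasure k r] with u hu
  rw [gammaMeasure_real_Ici hk hr hu.le, mul_pow, truncExp_pow, ← Real.exp_nat_mul, Finset.mul_sum,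
    Finset.mul_sum]
  refine Finset.sum_congr rfl fun n _ => ?_
  rw [Real.rpow_add hu, Real.rpow_natCast, mul_pow, mul_neg, mul_assoc (i : ℝ)]
  ring

theorem integrable_rpow_mul_gammaMeasure_real_Ici_pow (hk : 0 < k) (hr : 0 < r)
    (hks : 0 < k + s) (i : ℕ) :
    Integrable (fun u => u ^ s * (gammaMeasure k r).real (Ici u) ^ i) (gammaMeasure k r) := by
  refine (integrable_congr (rpow_mul_gammaMeasure_real_Ici_pow_ae_eq hk hr s i)).2 ?_
  refine integrable_finsetSum _ fun n _ => Integrable.const_mul ?_ _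
  exact integrable_rpow_mul_exp_neg_mul_gammaMeasure (by exact_mod_cast hk) hr
    (by have := (weight n).cast_nonneg (α := ℝ); linarith) (by positivity)

theorem integral_rpow_mul_gammaMeasure_real_Ici_pow (hk : 0 < k) (hr : 0 < r) (hks : 0 < k + s)
    (i : ℕ) :
    ∫ u, u ^ s * (gammaMeasure k r).real (Ici u) ^ i ∂gammaMeasure k r =
      ∑ n ∈ (Finset.univ : Finset (Fin k)).piAntidiag i, truncExpCoeff n *
        (r ^ (-s) * Real.Gamma (k + s + weight n) /
          (Real.Gamma k * (i + 1) ^ (k + s + weight n))) := by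
  have hk_pos : (0 : ℝ) < k := by exact_mod_cast hk
  have hexponent : ∀ n : Fin k → ℕ, 0 < (k : ℝ) + (s + weight n) := fun n => by
    have := (weight n).cast_nonneg (α := ℝ)
    linarith
  have hrate : 0 < r + i * r := by positivity
  rw [integral_congr_ae (rpow_mul_gammaMeasure_real_Ici_pow_ae_eq hk hr s i),
    integral_finsetSum _ fun n _ => (integrable_rpow_mul_exp_neg_mul_gammaMeasure hk_pos hr
      (hexponent n) hrate).const_mul _]
  refine Finset.sum_congr rfl fun n _ => ?_
  rw [integral_const_mul, integral_rpow_mul_exp_neg_mul_gammaMeasure hk_pos hr (hexponent n) hrate,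
    show r + i * r = r * (i + 1) by ring, Real.mul_rpow hr.le (by positivity), ← add_assoc,
    Real.rpow_add hr _ (weight n : ℝ), Real.rpow_add hr, Real.rpow_natCast r (weight n),
    Real.rpow_neg hr.le]
  field_simp

theorem integral_rpow_mul_gammaMeasure_real_Ici_pow_eq_sum_choose (hk : 0 < k) (hr : 0 < r)
    (hks : 0 < k + s) (n : ℕ) :
    ∫ u, u ^ s * (gammaMeasure k r).real (Ici u) ^ n ∂gammaMeasure k r =
      ∑ i₁ ∈ Finset.range (n + 1), ∑ i₂ ∈ Finset.range (i₁ + 1),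
        (n.choose i₁ : ℝ) * (i₁.choose i₂ : ℝ) * ((-1) ^ (i₁ + i₂) *
          ∫ u, u ^ s * (gammaMeasure k r).real (Ici u) ^ i₂ ∂gammaMeasure k r) := by
  have hint := fun i => integrable_rpow_mul_gammaMeasure_real_Ici_pow hk hr hks i
  have hexpand : ∀ u, u ^ s * (gammaMeasure k r).real (Ici u) ^ n =
      ∑ i₁ ∈ Finset.range (n + 1), ∑ i₂ ∈ Finset.range (i₁ + 1),
        (n.choose i₁ : ℝ) * (i₁.choose i₂ : ℝ) * ((-1) ^ (i₁ + i₂) *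
          (u ^ s * (gammaMeasure k r).real (Ici u) ^ i₂)) := fun u => by
    rw [pow_eq_sum_choose_mul_choose _ n]
    simp only [Finset.mul_sum]
    exact Finset.sum_congr rfl fun i _ => Finset.sum_congr rfl fun j _ => by ring
  simp only [hexpand]
  rw [integral_finsetSum _ fun i _ => integrable_finsetSum _ fun j _ =>
    ((hint j).const_mul _).const_mul _]
  refine Finset.sum_congr rfl fun i _ => ?_
  rw [integral_finsetSum _ fun j _ => ((hint j).const_mul _).const_mul _]
  simp only [integral_const_mul]

end MinimumMoments

section ClosedForm

theorem two_rpow_mul_sqrt_pi_div_Gamma_mul_Gamma_add_half {a : ℝ} (ha : 0 < a) :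
    2 ^ (3 - 2 * a) * √Real.pi / (Real.Gamma a * Real.Gamma (a + 1 / 2)) =
      4 / Real.Gamma (2 * a) := by
  rw [Real.Gamma_mul_Gamma_add_half_of_pos ha, show 3 - 2 * a = 2 + (1 - 2 * a) by ring,
    Real.rpow_add two_pos, Real.rpow_two]
  field_simp
  norm_num

theorem coeffA_eq {k i₁ i₂ : ℕ} {n : Fin k → ℕ} (hn : ∑ j, n j = i₂) :
    coeffA i₁ i₂ n = truncExpCoeff n * 2 ^ weight n * (-1) ^ (i₁ + i₂) := by
  have hmultinomial : (i₂ ! : ℝ) / ∏ j, ((n j)! : ℝ) = Nat.multinomial Finset.univ n := by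
    rw [div_eq_iff (Finset.prod_ne_zero_iff.2 fun j _ => by positivity), ← hn,
      ← Nat.multinomial_spec Finset.univ n]
    push_cast
    ring
  rw [coeffA, hmultinomial, prod_pow_mul_eq_pow_weight_mul_prod, truncExpCoeff]
  ring

variable {k : ℕ} {α : Fin 2 → ℝ}

theorem expoQ_eq (hk : (k : ℝ) = 2 * α 0) (hα : α 1 = α 0 + 1 / 2) (n : Fin k → ℕ) :
    expoQ α n = k + 1 / 2 + weight n := by
  rw [expoQ, hk, hα, weight]
  push_cast
  ring

theorem closedFormASNR_term_eq {r : ℝ} (hr : 0 < r) (hα₀ : 0 < α 0) (hk : (k : ℝ) = 2 * α 0)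
    (hα : α 1 = α 0 + 1 / 2) (c : ℝ) {i₁ i₂ : ℕ} {n : Fin k → ℕ} (hn : ∑ j, n j = i₂) :
    coeffA i₁ i₂ n * (c * r ^ 2) * (2 : ℝ) ^ (7 / 2 - expoQ α n) * √Real.pi *
        Real.Gamma (expoQ α n - 5 / 2) / ((i₂ : ℝ) + 1) ^ (expoQ α n - 5 / 2) /
        (Real.Gamma (α 0) * Real.Gamma (α 1)) =
      4 * c * (-1) ^ (i₁ + i₂) * (truncExpCoeff n *
        (r ^ (-(-2 : ℝ)) * Real.Gamma (k + -2 + weight n) /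
          (Real.Gamma k * (i₂ + 1) ^ ((k : ℝ) + -2 + weight n)))) := by
  have hconst := two_rpow_mul_sqrt_pi_div_Gamma_mul_Gamma_add_half hα₀
  rw [← hα, ← hk] at hconst
  rw [coeffA_eq hn, expoQ_eq hk hα,
    show (7 : ℝ) / 2 - (k + 1 / 2 + weight n) = 3 - k - weight n by ring,
    show (k : ℝ) + 1 / 2 + weight n - 5 / 2 = k + -2 + weight n by ring,
    Real.rpow_sub two_pos _ (weight n), Real.rpow_natCast, neg_neg, Real.rpow_two]
  calc _ = (2 ^ (3 - (k : ℝ)) * √Real.pi / (Real.Gamma (α 0) * Real.Gamma (α 1))) *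
        (c * (-1) ^ (i₁ + i₂) * (truncExpCoeff n * (r ^ 2 * Real.Gamma (k + -2 + weight n) /
          (i₂ + 1) ^ ((k : ℝ) + -2 + weight n)))) := by
        field_simp
    _ = _ := by
        rw [hconst]
        ring

theorem closedFormASNR_succ_eq_integral {r : ℝ} (hr : 0 < r) (hα₀ : 1 < α 0)
    (hk : (k : ℝ) = 2 * α 0) (hα : α 1 = α 0 + 1 / 2) (c : ℝ) (n : ℕ) :
    closedFormASNR (n + 1) k α (c * r ^ 2) =
      c * ((n + 1 : ℕ) * ∫ u, 4 * u ^ (-2 : ℝ) * (gammaMeasure k r).real (Ici u) ^ n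
        ∂gammaMeasure k r) := by
  have hk_pos : 0 < k := by
    have : (0 : ℝ) < k := by linarith
    exact_mod_cast this
  have hshape : (0 : ℝ) < k + -2 := by linarith
  simp only [mul_assoc (4 : ℝ)]
  rw [integral_const_mul,
    integral_rpow_mul_gammaMeasure_real_Ici_pow_eq_sum_choose hk_pos hr hshape, closedFormASNR,
    Nat.add_sub_cancel]
  simp only [Finset.mul_sum]
  refine Finset.sum_congr rfl fun i₁ _ => Finset.sum_congr rfl fun i₂ _ => ?_
  rw [integral_rpow_mul_gammaMeasure_real_Ici_pow hk_pos hr hshape]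
  simp only [Finset.mul_sum]
  refine Finset.sum_congr rfl fun m hm => ?_
  have hterm := closedFormASNR_term_eq hr (by linarith) hk hα c (i₁ := i₁)
    (Finset.mem_piAntidiag.1 hm).1
  push_cast
  linear_combination (n + 1 : ℝ) * n.choose i₁ * i₁.choose i₂ * hterm

end ClosedForm

section Independence

variable {W ι κ E : Type*} [MeasurableSpace W] [MeasurableSpace E] {P : Measure W}

theorem ae_ne_of_indepFun [MeasurableEq E] [IsFiniteMeasure P] {X Y : W → E}
    (hX : AEMeasurable X P) (hY : AEMeasurable Y P) (hXY : IndepFun X Y P)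
    [NullSingletonClass (P.map Y)] : ∀ᵐ w ∂P, X w ≠ Y w := by
  have hdiag : MeasurableSet {p : E × E | p.1 = p.2} := measurableSet_diagonal
  have hzero : (P.map fun w => (X w, Y w)) {p | p.1 = p.2} = 0 := by
    rw [hXY.map_prod_eq_prod_map_map hX hY, Measure.measure_prod_null hdiag]
    refine ae_of_all _ fun x => ?_
    simp [preimage]
  rw [Measure.map_apply_of_aemeasurable (hX.prodMk hY) hdiag] at hzero
  exact measure_eq_zero_iff_ae_notMem.1 hzero

theorem map_mul_absolutelyContinuous [IsFiniteMeasure P] {X Y : W → ℝ} (hX : AEMeasurable X P)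
    (hY : AEMeasurable Y P) (hXY : IndepFun X Y P) (hX_ne : ∀ᵐ w ∂P, X w ≠ 0)
    (hac : P.map Y ≪ volume) : P.map (fun w => X w * Y w) ≪ volume := by
  refine Measure.AbsolutelyContinuous.mk fun s hs hs_null => ?_
  have hmeas : MeasurableSet {p : ℝ × ℝ | p.1 * p.2 ∈ s} := measurable_mul hs
  have hX_ne' : ∀ᵐ x ∂P.map X, x ≠ 0 :=
    (ae_map_iff hX (measurableSet_singleton (0 : ℝ)).compl).2 hX_ne
  have hmap : P.map (fun w => X w * Y w) s = (P.map X).prod (P.map Y) {p | p.1 * p.2 ∈ s} := by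
    rw [← hXY.map_prod_eq_prod_map_map hX hY, Measure.map_apply_of_aemeasurable (by fun_prop) hs,
      Measure.map_apply_of_aemeasurable (by fun_prop) hmeas]
    rfl
  rw [hmap, Measure.measure_prod_null hmeas]
  filter_upwards [hX_ne'] with x hx
  refine hac ?_
  change volume ((x * ·) ⁻¹' s) = 0
  rw [Real.volume_preimage_mul_left hx, hs_null, mul_zero]

theorem iIndepFun_curry {X : ι → κ → W → E} (hX : ∀ i j, Measurable (X i j))
    (hindep : iIndepFun (fun p : ι × κ => X p.1 p.2) P) :
    iIndepFun (fun i w j => X i j w) P := by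
  have := hindep.isProbabilityMeasure
  have hprob : ∀ i j, IsProbabilityMeasure (P.map (X i j)) :=
    fun i j => Measure.isProbabilityMeasure_map (hX i j).aemeasurable
  have hpair : P.map (fun w (p : ι × κ) => X p.1 p.2 w) =
      Measure.infinitePi fun p : ι × κ => P.map (X p.1 p.2) :=
    (iIndepFun_iff_map_fun_eq_infinitePi_map fun p : ι × κ => hX p.1 p.2).1 hindep
  have hrow : ∀ i, P.map (fun w j => X i j w) = Measure.infinitePi fun j => P.map (X i j) :=
    fun i => (iIndepFun_iff_map_fun_eq_infinitePi_map (hX i)).1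
      (hindep.precomp (g := fun j => (i, j)) (Prod.mk_right_injective i))
  rw [iIndepFun_iff_map_fun_eq_infinitePi_map fun i => measurable_pi_lambda _ (hX i)]
  simp only [hrow]
  rw [← Measure.infinitePi_map_curry fun i j => P.map (X i j), ← hpair,
    Measure.map_map (MeasurableEquiv.measurable _) (by fun_prop)]
  rfl

theorem indepFun_of_iIndepFun_sumElim {X : ι → W → E} {Y : κ → W → E}
    (hX : ∀ i, Measurable (X i)) (hY : ∀ j, Measurable (Y j))
    (hindep : iIndepFun (Sum.elim X Y) P) :
    IndepFun (fun w i => X i w) (fun w j => Y j w) P := by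
  have hle : ∀ p, MeasurableSpace.comap (Sum.elim X Y p) inferInstance ≤ ‹MeasurableSpace W› := by
    rintro (i | j)
    exacts [(hX i).comap_le, (hY j).comap_le]
  have hsup := indep_iSup_of_disjoint hle hindep.iIndep
    (isCompl_range_inl_range_inr (α := ι) (β := κ)).disjoint
  rw [IndepFun_iff_Indep]
  simpa only [iSup_range, Sum.elim_inl, Sum.elim_inr, MeasurableSpace.pi,
    MeasurableSpace.comap_iSup, MeasurableSpace.comap_comp, Function.comp_def] using hsup

end Independence

section Selection

theorem apply_eq_sum_indicator_preimage {W ι M : Type*} [AddCommMonoid M] [Fintype ι]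
    (sel : W → ι) (f : ι → W → M) (w : W) :
    f (sel w) w = ∑ i, (sel ⁻¹' {i}).indicator (f i) w := by
  rw [Finset.sum_eq_single (sel w) (fun i _ hi => by simp [hi.symm]) (by simp)]
  simp

theorem mul_apply_sel_eq_sum {W ι R : Type*} [NonUnitalNonAssocSemiring R] [Fintype ι]
    (sel : W → ι) (X Y : ι → W → R) (w : W) :
    X (sel w) w * Y (sel w) w = ∑ i, X i w * (sel ⁻¹' {i}).indicator (Y i) w := by
  simpa only [indicator_mul_right] using
    apply_eq_sum_indicator_preimage sel (fun i w => X i w * Y i w) w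

variable {W ι : Type*} [MeasurableSpace W] {P : Measure W} {sel : W → ι}

theorem preimage_singleton_ae_eq_of_forall_le {E : Type*} [PartialOrder E] {Y : ι → W → E}
    (hmax : ∀ᵐ w ∂P, ∀ i, Y i w ≤ Y (sel w) w)
    (hinj : ∀ᵐ w ∂P, ∀ i j, i ≠ j → Y i w ≠ Y j w) (i : ι) :
    sel ⁻¹' {i} =ᵐ[P] {w | ∀ j, Y j w ≤ Y i w} := by
  filter_upwards [hmax, hinj] with w hmax hinj
  refine propext ⟨fun hi => ?_, fun hle => ?_⟩
  · obtain rfl : sel w = i := hi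
    exact hmax
  · by_contra hne
    exact hinj _ _ hne (le_antisymm (hle _) (hmax i))

theorem map_apply_sel_absolutelyContinuous {E : Type*} [MeasurableSpace E] [Countable ι]
    {μ : Measure E} {X : ι → W → E} (hX : ∀ i, Measurable (X i))
    (hsel : Measurable fun w => X (sel w) w) (hac : ∀ i, P.map (X i) ≪ μ) :
    P.map (fun w => X (sel w) w) ≪ μ := by
  refine Measure.AbsolutelyContinuous.mk fun s hs hs_null => ?_
  have havoid : ∀ᵐ w ∂P, ∀ i, X i w ∉ s := ae_all_iff.2 fun i => by
    have := hac i hs_null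
    rw [Measure.map_apply (hX i) hs] at this
    exact measure_eq_zero_iff_ae_notMem.1 this
  rw [Measure.map_apply hsel hs]
  refine measure_eq_zero_iff_ae_notMem.2 ?_
  filter_upwards [havoid] with w hw using hw (sel w)

variable {X Y : ι → W → ℝ}

theorem integrable_mul_apply_sel [Finite ι] (hX : ∀ i, Integrable (X i) P)
    (hY : ∀ i, Integrable ((sel ⁻¹' {i}).indicator (Y i)) P)
    (hXY : ∀ i, IndepFun (X i) ((sel ⁻¹' {i}).indicator (Y i)) P) :
    Integrable (fun w => X (sel w) w * Y (sel w) w) P := by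
  have := Fintype.ofFinite ι
  simp only [mul_apply_sel_eq_sum]
  exact integrable_finsetSum _ fun i _ => (hXY i).integrable_mul (hX i) (hY i)

theorem integral_mul_apply_sel [Fintype ι] (hX : ∀ i, Integrable (X i) P)
    (hY : ∀ i, Integrable ((sel ⁻¹' {i}).indicator (Y i)) P)
    (hXY : ∀ i, IndepFun (X i) ((sel ⁻¹' {i}).indicator (Y i)) P) :
    ∫ w, X (sel w) w * Y (sel w) w ∂P =
      ∑ i, (∫ w, X i w ∂P) * ∫ w, (sel ⁻¹' {i}).indicator (Y i) w ∂P := by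
  have hprod : ∀ i, Integrable (fun w => X i w * (sel ⁻¹' {i}).indicator (Y i) w) P :=
    fun i => (hXY i).integrable_mul (hX i) (hY i)
  simp only [mul_apply_sel_eq_sum]
  rw [integral_finsetSum _ fun i _ => hprod i]
  exact Finset.sum_congr rfl fun i _ => (hXY i).integral_fun_mul_eq_mul_integral
    (hX i).aestronglyMeasurable (hY i).aestronglyMeasurable

end Selection

section Minimum

variable {n : ℕ} {ν : Measure ℝ} [IsProbabilityMeasure ν] {f : ℝ → ℝ}

theorem integrable_indicator_forall_le_prod (hf : Integrable f ν) :
    Integrable ({p : ℝ × (Fin n → ℝ) | ∀ j, p.1 ≤ p.2 j}.indicator fun p => f p.1)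
      (ν.prod (Measure.pi fun _ => ν)) := by
  refine (hf.comp_fst (Measure.pi fun _ : Fin n => ν)).indicator ?_
  simp only [ofPred_forall]
  exact MeasurableSet.iInter fun j => measurableSet_le (by fun_prop) (by fun_prop)

theorem indicator_forall_le_eq_comp_piFinSuccAbove (i : Fin (n + 1)) (f : ℝ → ℝ) :
    ({x : Fin (n + 1) → ℝ | ∀ j, x i ≤ x j}.indicator fun x => f (x i)) =
      ({p : ℝ × (Fin n → ℝ) | ∀ j, p.1 ≤ p.2 j}.indicator fun p => f p.1) ∘
        MeasurableEquiv.piFinSuccAbove (fun _ => ℝ) i := by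
  ext x
  simp [indicator, Fin.forall_iff_succAbove i, Fin.removeNth]

theorem integrable_indicator_forall_le_pi (i : Fin (n + 1)) (hf : Integrable f ν) :
    Integrable ({x : Fin (n + 1) → ℝ | ∀ j, x i ≤ x j}.indicator fun x => f (x i))
      (Measure.pi fun _ => ν) := by
  rw [indicator_forall_le_eq_comp_piFinSuccAbove,
    (measurePreserving_piFinSuccAbove (fun _ => ν) i).integrable_comp_emb
      (MeasurableEquiv.measurableEmbedding _)]
  exact integrable_indicator_forall_le_prod hf

theorem integral_indicator_forall_le_pi (i : Fin (n + 1)) (hf : Integrable f ν) :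
    ∫ x, {x : Fin (n + 1) → ℝ | ∀ j, x i ≤ x j}.indicator (fun x => f (x i)) x
      ∂(Measure.pi fun _ => ν) = ∫ u, f u * ν.real (Ici u) ^ n ∂ν := by
  rw [indicator_forall_le_eq_comp_piFinSuccAbove]
  refine ((measurePreserving_piFinSuccAbove (fun _ => ν) i).integral_comp
    (MeasurableEquiv.measurableEmbedding _) _).trans ?_
  rw [integral_prod _ (integrable_indicator_forall_le_prod hf)]
  congr 1 with u
  have hsection : ∀ y : Fin n → ℝ,
      {p : ℝ × (Fin n → ℝ) | ∀ j, p.1 ≤ p.2 j}.indicator (fun p => f p.1) (u, y) =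
        (univ.pi fun _ => Ici u).indicator (fun _ => f u) y := fun y => by
    simp [indicator, Pi.le_def]
  simp only [hsection]
  rw [integral_indicator_const _ (MeasurableSet.univ_pi fun _ => measurableSet_Ici),
    measureReal_def, Measure.pi_pi]
  simp [measureReal_def, mul_comm]

end Minimum

theorem averageSNR_eq_integral {W : Type*} [MeasurableSpace W] {P : Measure W} [IsFiniteMeasure P]
    {X : W → ℝ} [HasPDF X P volume] (hX : ∀ᵐ w ∂P, 0 ≤ X w) :
    averageSNR P X = ∫ w, X w ∂P := by
  have hindicator : ∀ᵐ w ∂P, (Ioi (0 : ℝ)).indicator id (X w) = X w := by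
    filter_upwards [hX] with w hw
    rcases hw.eq_or_lt with hzero | hpos
    · simp [← hzero]
    · simp [hpos]
  rw [averageSNR, ← integral_congr_ae hindicator, ← pdf.integral_pdf_smul (μ := volume)
    (f := (Ioi (0 : ℝ)).indicator id)
    (measurable_id.indicator measurableSet_Ioi).aestronglyMeasurable,
    ← integral_indicator measurableSet_Ioi]
  refine integral_congr_ae (ae_of_all _ fun x => ?_)
  by_cases hx : x ∈ Ioi (0 : ℝ) <;> simp [hx, mul_comm]

/-- The variable `2 / √I_i`, which is largest when the total shadowing `I_i` is smallest. It is
written in terms of the inverses `(S i j)⁻¹`, whose laws are gamma. -/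
noncomputable def invSqrtShadowing {W : Type*} {L : ℕ} (S : Fin L → Fin 2 → W → ℝ) (i : Fin L)
    (w : W) : ℝ :=
  2 * √((S i 0 w)⁻¹ * (S i 1 w)⁻¹)

section Channel

variable {W : Type*} {L : ℕ} {N S : Fin L → Fin 2 → W → ℝ} {i j : Fin L} {w : W}

theorem totalFading_eq_sq_mul_sq (N : Fin L → Fin 2 → W → ℝ) (i : Fin L) :
    totalFading N i = fun w => N i 0 w ^ 2 * N i 1 w ^ 2 :=
  funext fun _ => mul_pow _ _ 2

theorem invSqrtShadowing_eq (S : Fin L → Fin 2 → W → ℝ) (i : Fin L) (w : W) :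
    invSqrtShadowing S i w = 2 * √(totalShadowing S i w)⁻¹ := by
  rw [invSqrtShadowing, totalShadowing, mul_inv]

theorem totalShadowing_eq_four_mul_rpow (hi : 0 < totalShadowing S i w) :
    totalShadowing S i w = 4 * invSqrtShadowing S i w ^ (-2 : ℝ) := by
  rw [invSqrtShadowing_eq, Real.rpow_neg (by positivity), Real.rpow_two,
    mul_pow, Real.sq_sqrt (by positivity)]
  field_simp
  norm_num

theorem totalShadowing_le_iff (hi : 0 < totalShadowing S i w) (hj : 0 < totalShadowing S j w) :
    totalShadowing S j w ≤ totalShadowing S i w ↔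
      invSqrtShadowing S i w ≤ invSqrtShadowing S j w := by
  rw [invSqrtShadowing_eq, invSqrtShadowing_eq, mul_le_mul_iff_right₀ two_pos,
    Real.sqrt_le_sqrt_iff (by positivity), inv_le_inv₀ hi hj]

theorem IsShadowingSelection.outputSNR_ae_eq [MeasurableSpace W] {P : Measure W} {sel : W → Fin L}
    (hsel : IsShadowingSelection P S sel) (N : Fin L → Fin 2 → W → ℝ) :
    outputSNR N S sel =ᵐ[P] fun w => totalFading N (sel w) w * totalShadowing S (sel w) w := by
  filter_upwards [hsel.maximal] with w hmax
  have : Nonempty (Fin L) := ⟨sel w⟩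
  rw [outputSNR, le_antisymm (ciSup_le hmax)
    (le_ciSup (f := fun i => totalShadowing S i w) (finite_range _).bddAbove (sel w))]

end Channel

namespace IsDoubleShadowing

variable {W : Type*} [MeasurableSpace W] {P : Measure W} {L : ℕ} {m : Fin 2 → ℝ} {Ω : ℝ}
  {α γ : Fin 2 → ℝ} {N S : Fin L → Fin 2 → W → ℝ} {sel : W → Fin L}

section Basic

variable (h : IsDoubleShadowing P L m Ω α γ N S)
include h

theorem measurable_totalFading (i : Fin L) : Measurable (totalFading N i) :=
  ((h.measurable_fading i 0).mul (h.measurable_fading i 1)).pow_const 2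

theorem measurable_totalShadowing (i : Fin L) : Measurable (totalShadowing S i) :=
  (h.measurable_shadowing i 0).mul (h.measurable_shadowing i 1)

theorem measurable_outputSNR (hsel : Measurable sel) : Measurable (outputSNR N S sel) := by
  have hfading : Measurable fun p : Fin L × W => totalFading N p.1 p.2 :=
    measurable_from_prod_countable_right h.measurable_totalFading
  exact (hfading.comp (hsel.prodMk measurable_id)).mul
    (Measurable.iSup h.measurable_totalShadowing)

theorem ae_totalFading_pos (i : Fin L) : ∀ᵐ w ∂P, 0 < totalFading N i w := by
  filter_upwards [ae_of_hasLaw (h.law_fading i 0) (ae_pos_gammaMeasure _ _),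
    ae_of_hasLaw (h.law_fading i 1) (ae_pos_gammaMeasure _ _)] with w hw₀ hw₁
  rw [totalFading_eq_sq_mul_sq]
  exact mul_pos hw₀ hw₁

theorem ae_shadowing_pos (i : Fin L) (j : Fin 2) : ∀ᵐ w ∂P, 0 < S i j w :=
  ae_of_hasLaw (h.law_shadowing i j) (ae_pos_invGammaMeasure _ _)

theorem ae_totalShadowing_pos : ∀ᵐ w ∂P, ∀ i, 0 < totalShadowing S i w :=
  ae_all_iff.2 fun i => by
    filter_upwards [h.ae_shadowing_pos i 0, h.ae_shadowing_pos i 1] with w hw₀ hw₁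
      using mul_pos hw₀ hw₁

theorem ae_outputSNR_nonneg (hsel : IsShadowingSelection P S sel) :
    ∀ᵐ w ∂P, 0 ≤ outputSNR N S sel w := by
  filter_upwards [hsel.outputSNR_ae_eq N, h.ae_totalShadowing_pos] with w hw hpos
  rw [hw]
  exact mul_nonneg (sq_nonneg _) (hpos _).le

theorem iIndepFun_shadowing : iIndepFun (fun i w j => S i j w) P :=
  iIndepFun_curry h.measurable_shadowing (h.indep.precomp Sum.inr_injective)

theorem indepFun_shadowing (i : Fin L) : IndepFun (S i 0) (S i 1) P :=
  h.indep.indepFun (i := Sum.inr (i, 0)) (j := Sum.inr (i, 1)) (by simp)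

theorem indepFun_fading_sq (i : Fin L) :
    IndepFun (fun w => N i 0 w ^ 2) (fun w => N i 1 w ^ 2) P :=
  (h.indep.indepFun (i := Sum.inl (i, 0)) (j := Sum.inl (i, 1)) (by simp)).comp
    (measurable_id.pow_const 2) (measurable_id.pow_const 2)

theorem iIndepFun_totalShadowing : iIndepFun (totalShadowing S) P :=
  h.iIndepFun_shadowing.comp (fun _ x => x 0 * x 1) fun _ => by fun_prop

theorem indepFun_totalFading_totalShadowing (i : Fin L) :
    IndepFun (totalFading N i) (fun w j => totalShadowing S j w) P :=
  (indepFun_of_iIndepFun_sumElim (fun p : Fin L × Fin 2 => h.measurable_fading p.1 p.2)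
    (fun p : Fin L × Fin 2 => h.measurable_shadowing p.1 p.2) h.indep).comp
    (show Measurable fun x : Fin L × Fin 2 → ℝ => (x (i, 0) * x (i, 1)) ^ 2 by fun_prop)
    (show Measurable fun (y : Fin L × Fin 2 → ℝ) j => y (j, 0) * y (j, 1) by fun_prop)

theorem integrable_fading_sq (hm : ∀ j, 0 < m j) (hΩ : 0 < Ω) (i : Fin L) (j : Fin 2) :
    Integrable (fun w => N i j w ^ 2) P := by
  have hid := integrable_id_gammaMeasure (hm j) (div_pos (hm j) hΩ)
  rw [← (h.law_fading i j).map_eq] at hid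
  exact hid.comp_aemeasurable (h.law_fading i j).aemeasurable

theorem integrable_totalFading (hm : ∀ j, 0 < m j) (hΩ : 0 < Ω) (i : Fin L) :
    Integrable (totalFading N i) P := by
  rw [totalFading_eq_sq_mul_sq]
  exact (h.indepFun_fading_sq i).integrable_mul (h.integrable_fading_sq hm hΩ i 0)
    (h.integrable_fading_sq hm hΩ i 1)

theorem integral_totalFading (hm : ∀ j, 0 < m j) (hΩ : 0 < Ω) (i : Fin L) :
    ∫ w, totalFading N i w ∂P = Ω ^ 2 := by
  have hmean : ∀ j, ∫ w, N i j w ^ 2 ∂P = Ω := fun j => by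
    rw [(h.law_fading i j).integral_eq, integral_id_gammaMeasure (hm j) (div_pos (hm j) hΩ),
      div_div_cancel₀ (hm j).ne']
  rw [totalFading_eq_sq_mul_sq, (h.indepFun_fading_sq i).integral_fun_mul_eq_mul_integral
    (h.integrable_fading_sq hm hΩ i 0).aestronglyMeasurable
    (h.integrable_fading_sq hm hΩ i 1).aestronglyMeasurable, hmean, hmean, sq]

theorem hasLaw_invSqrtShadowing (hα₀ : 0 < α 0) (hα : α 1 = α 0 + 1 / 2) (hγ : ∀ j, 0 < γ j)
    (i : Fin L) :
    HasLaw (invSqrtShadowing S i) (gammaMeasure (2 * α 0) √(γ 0 * γ 1)) P := by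
  have hinv : ∀ j, HasLaw (fun w => (S i j w)⁻¹) (gammaMeasure (α j) (γ j)) P := fun j =>
    HasLaw.fun_comp ⟨measurable_inv.aemeasurable, map_inv_invGammaMeasure _ _⟩ (h.law_shadowing i j)
  exact hasLaw_two_mul_sqrt_mul hα₀ (hγ 0) (hγ 1) (hinv 0) (hα ▸ hinv 1)
    ((h.indepFun_shadowing i).comp measurable_inv measurable_inv)

theorem hasLaw_pi_invSqrtShadowing (hα₀ : 0 < α 0) (hα : α 1 = α 0 + 1 / 2) (hγ : ∀ j, 0 < γ j) :
    HasLaw (fun w i => invSqrtShadowing S i w)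
      (Measure.pi fun _ : Fin L => gammaMeasure (2 * α 0) √(γ 0 * γ 1)) P :=
  iIndepFun.hasLaw_pi (h.hasLaw_invSqrtShadowing hα₀ hα hγ)
    (h.iIndepFun_shadowing.comp (fun _ x => 2 * √((x 0)⁻¹ * (x 1)⁻¹)) fun _ => by fun_prop)

theorem indicator_totalShadowing_ae_eq (i : Fin L) :
    {w | ∀ j, totalShadowing S j w ≤ totalShadowing S i w}.indicator (totalShadowing S i) =ᵐ[P]
      fun w => {x : Fin L → ℝ | ∀ j, x i ≤ x j}.indicator (fun x => 4 * x i ^ (-2 : ℝ))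
        fun i => invSqrtShadowing S i w := by
  filter_upwards [h.ae_totalShadowing_pos] with w hpos
  have hset : (∀ j, totalShadowing S j w ≤ totalShadowing S i w) ↔
      ∀ j, invSqrtShadowing S i w ≤ invSqrtShadowing S j w :=
    forall_congr' fun j => totalShadowing_le_iff (hpos i) (hpos j)
  simp only [indicator, mem_ofPred_eq, hset, ← totalShadowing_eq_four_mul_rpow (hpos i)]

theorem map_totalShadowing_absolutelyContinuous (i : Fin L) :
    P.map (totalShadowing S i) ≪ volume := by
  have := h.indep.isProbabilityMeasure
  refine map_mul_absolutelyContinuous (h.measurable_shadowing i 0).aemeasurable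
    (h.measurable_shadowing i 1).aemeasurable (h.indepFun_shadowing i) ?_ ?_
  · filter_upwards [h.ae_shadowing_pos i 0] with w hw using hw.ne'
  · rw [(h.law_shadowing i 1).map_eq]
    exact withDensity_absolutelyContinuous _ _

theorem ae_totalShadowing_ne :
    ∀ᵐ w ∂P, ∀ i j, i ≠ j → totalShadowing S i w ≠ totalShadowing S j w := by
  simp only [ae_all_iff]
  intro i j hij
  have := h.indep.isProbabilityMeasure
  have : NullSingletonClass (P.map (totalShadowing S j)) :=
    ⟨fun x => h.map_totalShadowing_absolutelyContinuous j (measure_singleton x)⟩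
  exact ae_ne_of_indepFun (h.measurable_totalShadowing i).aemeasurable
    (h.measurable_totalShadowing j).aemeasurable (h.iIndepFun_totalShadowing.indepFun hij)

theorem map_totalFading_mul_totalShadowing_absolutelyContinuous (i : Fin L) :
    P.map (fun w => totalFading N i w * totalShadowing S i w) ≪ volume := by
  have := h.indep.isProbabilityMeasure
  refine map_mul_absolutelyContinuous (h.measurable_totalFading i).aemeasurable
    (h.measurable_totalShadowing i).aemeasurable
    ((h.indepFun_totalFading_totalShadowing i).comp measurable_id (measurable_pi_apply i)) ?_
    (h.map_totalShadowing_absolutelyContinuous i)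
  filter_upwards [h.ae_totalFading_pos i] with w hw using hw.ne'

theorem hasPDF_outputSNR (hsel : IsShadowingSelection P S sel) :
    HasPDF (outputSNR N S sel) P volume := by
  have := h.indep.isProbabilityMeasure
  have := h.indep.isProbabilityMeasure
  have := h.indep.isProbabilityMeasure
  have := h.indep.isProbabilityMeasure
  have := h.indep.isProbabilityMeasure
  have hmeas := h.measurable_outputSNR hsel.measurable_sel
  have hprod : ∀ i, Measurable fun w => totalFading N i w * totalShadowing S i w :=
    fun i => (h.measurable_totalFading i).mul (h.measurable_totalShadowing i)
  rw [Real.hasPDF_iff_of_aemeasurable hmeas.aemeasurable,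
    Measure.map_congr (hsel.outputSNR_ae_eq N)]
  refine map_apply_sel_absolutelyContinuous hprod ?_
    h.map_totalFading_mul_totalShadowing_absolutelyContinuous
  exact (measurable_from_prod_countable_right (f := fun p : Fin L × W =>
    totalFading N p.1 p.2 * totalShadowing S p.1 p.2) hprod).comp
      (hsel.measurable_sel.prodMk measurable_id)

theorem indicator_preimage_sel_ae_eq (hsel : IsShadowingSelection P S sel) (i : Fin L) :
    (sel ⁻¹' {i}).indicator (totalShadowing S i) =ᵐ[P]
      {w | ∀ j, totalShadowing S j w ≤ totalShadowing S i w}.indicator (totalShadowing S i) :=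
  indicator_ae_eq_of_ae_eq_set
    (preimage_singleton_ae_eq_of_forall_le hsel.maximal h.ae_totalShadowing_ne i)

theorem indepFun_totalFading_indicator (hsel : IsShadowingSelection P S sel) (i : Fin L) :
    IndepFun (totalFading N i) ((sel ⁻¹' {i}).indicator (totalShadowing S i)) P := by
  have hlargest : MeasurableSet {x : Fin L → ℝ | ∀ j, x j ≤ x i} := by
    simp only [ofPred_forall]
    exact MeasurableSet.iInter fun j => measurableSet_le (by fun_prop) (by fun_prop)
  exact ((h.indepFun_totalFading_totalShadowing i).comp measurable_id
    ((measurable_pi_apply i).indicator hlargest)).congr Filter.EventuallyEq.rfl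
    (h.indicator_preimage_sel_ae_eq hsel i).symm

end Basic

section Mean

variable {n : ℕ} {N S : Fin (n + 1) → Fin 2 → W → ℝ} {sel : W → Fin (n + 1)}
  (h : IsDoubleShadowing P (n + 1) m Ω α γ N S) (hsel : IsShadowingSelection P S sel)
  (hα₀ : 1 < α 0) (hα : α 1 = α 0 + 1 / 2) (hγ : ∀ j, 0 < γ j)
include h hsel hα₀ hα hγ

theorem integrable_indicator_preimage_sel (i : Fin (n + 1)) :
    Integrable ((sel ⁻¹' {i}).indicator (totalShadowing S i)) P := by
  have hrate : 0 < √(γ 0 * γ 1) := Real.sqrt_pos.2 (mul_pos (hγ 0) (hγ 1))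
  have := isProbabilityMeasure_gammaMeasure (a := 2 * α 0) (by linarith) hrate
  have hlaw := h.hasLaw_pi_invSqrtShadowing (by linarith) hα hγ
  have hpi := integrable_indicator_forall_le_pi i
    ((integrable_rpow_gammaMeasure (a := 2 * α 0) (s := -2) (by linarith) hrate
      (by linarith)).const_mul 4)
  rw [← hlaw.map_eq] at hpi
  exact (integrable_congr ((h.indicator_preimage_sel_ae_eq hsel i).trans
    (h.indicator_totalShadowing_ae_eq i))).2 (hpi.comp_aemeasurable hlaw.aemeasurable)

theorem integral_indicator_preimage_sel (i : Fin (n + 1)) :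
    ∫ w, (sel ⁻¹' {i}).indicator (totalShadowing S i) w ∂P =
      ∫ u, 4 * u ^ (-2 : ℝ) * (gammaMeasure (2 * α 0) √(γ 0 * γ 1)).real (Ici u) ^ n
        ∂gammaMeasure (2 * α 0) √(γ 0 * γ 1) := by
  have hrate : 0 < √(γ 0 * γ 1) := Real.sqrt_pos.2 (mul_pos (hγ 0) (hγ 1))
  have := isProbabilityMeasure_gammaMeasure (a := 2 * α 0) (by linarith) hrate
  have hpow : Integrable (fun u : ℝ => 4 * u ^ (-2 : ℝ)) (gammaMeasure (2 * α 0) √(γ 0 * γ 1)) :=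
    (integrable_rpow_gammaMeasure (by linarith) hrate (by linarith)).const_mul 4
  rw [integral_congr_ae ((h.indicator_preimage_sel_ae_eq hsel i).trans
    (h.indicator_totalShadowing_ae_eq i)), ← integral_indicator_forall_le_pi i hpow]
  exact (h.hasLaw_pi_invSqrtShadowing (by linarith) hα hγ).integral_comp
    (integrable_indicator_forall_le_pi i hpow).aestronglyMeasurable

theorem integrable_outputSNR (hm : ∀ j, 0 < m j) (hΩ : 0 < Ω) :
    Integrable (outputSNR N S sel) P :=
  (integrable_congr (hsel.outputSNR_ae_eq N)).2 <|
    integrable_mul_apply_sel (h.integrable_totalFading hm hΩ)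
      (h.integrable_indicator_preimage_sel hsel hα₀ hα hγ)
      (h.indepFun_totalFading_indicator hsel)

theorem integral_outputSNR (hm : ∀ j, 0 < m j) (hΩ : 0 < Ω) {k : ℕ}
    (hk : (k : ℝ) = 2 * α 0) :
    ∫ w, outputSNR N S sel w ∂P = closedFormASNR (n + 1) k α (Ω ^ 2 * (γ 0 * γ 1)) := by
  have hγ_pos : 0 < γ 0 * γ 1 := mul_pos (hγ 0) (hγ 1)
  rw [integral_congr_ae (hsel.outputSNR_ae_eq N),
    integral_mul_apply_sel (h.integrable_totalFading hm hΩ)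
      (h.integrable_indicator_preimage_sel hsel hα₀ hα hγ)
      (h.indepFun_totalFading_indicator hsel)]
  simp only [h.integral_totalFading hm hΩ, h.integral_indicator_preimage_sel hsel hα₀ hα hγ, ← hk]
  rw [← Finset.mul_sum, Finset.sum_const, Finset.card_univ, Fintype.card_fin, nsmul_eq_mul,
    ← closedFormASNR_succ_eq_integral (Real.sqrt_pos.2 hγ_pos) hα₀ hk hα, Real.sq_sqrt hγ_pos.le]

theorem averageSNR_outputSNR (hm : ∀ j, 0 < m j) (hΩ : 0 < Ω) {k : ℕ}
    (hk : (k : ℝ) = 2 * α 0) :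
    averageSNR P (outputSNR N S sel) =
      closedFormASNR (n + 1) k α (Ω ^ 2 * (γ 0 * γ 1)) := by
  have := h.indep.isProbabilityMeasure
  have := h.hasPDF_outputSNR hsel
  rw [averageSNR_eq_integral (h.ae_outputSNR_nonneg hsel),
    h.integral_outputSNR hsel hα₀ hα hγ hm hΩ hk]

end Mean

end IsDoubleShadowing

end UAVSelection

theorem mainTheorem8 {W : Type*} [MeasurableSpace W] (P : Measure W) [IsProbabilityMeasure P]
    (L : ℕ) (hL : 1 ≤ L) (m : Fin 2 → ℝ) (hm : ∀ j, 0 < m j) (Ω : ℝ) (hΩ : 0 < Ω)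
    (α : Fin 2 → ℝ) (hα : ∀ j, 1 < α j) (hα' : α 1 = α 0 + 1 / 2)
    (k : ℕ) (hk : (k : ℝ) = 2 * α 0)
    (γ : Fin 2 → ℝ) (hγ : ∀ j, 0 < γ j)
    (N S : Fin L → Fin 2 → W → ℝ) (hNS : UAVSelection.IsDoubleShadowing P L m Ω α γ N S)
    (sel : W → Fin L) (hsel : UAVSelection.IsShadowingSelection P S sel) :
    HasPDF (UAVSelection.outputSNR N S sel) P volume ∧
    Integrable (UAVSelection.outputSNR N S sel) P ∧
    IntegrableOn (fun x => x * (pdf (UAVSelection.outputSNR N S sel) P volume x).toReal)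
      (Ioi (0 : ℝ)) ∧
    UAVSelection.averageSNR P (UAVSelection.outputSNR N S sel)
      = UAVSelection.closedFormASNR L k α (Ω ^ 2 * (γ 0 * γ 1)) ∧
    P[UAVSelection.outputSNR N S sel]
      = UAVSelection.closedFormASNR L k α (Ω ^ 2 * (γ 0 * γ 1)) ∧
    ∀ (W' : Type*) [MeasurableSpace W'] (P' : Measure W') [IsProbabilityMeasure P']
      (m' : Fin 2 → ℝ) (_ : ∀ j, 0 < m' j) (N' S' : Fin L → Fin 2 → W' → ℝ)
      (_ : UAVSelection.IsDoubleShadowing P' L m' Ω α γ N' S')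
      (sel' : W' → Fin L) (_ : UAVSelection.IsShadowingSelection P' S' sel'),
      UAVSelection.averageSNR P' (UAVSelection.outputSNR N' S' sel')
        = UAVSelection.averageSNR P (UAVSelection.outputSNR N S sel) := by
  obtain ⟨n, rfl⟩ := Nat.exists_eq_add_one.2 hL
  have hint := hNS.integrable_outputSNR hsel (hα 0) hα' hγ hm hΩ
  have hmean := hNS.integral_outputSNR hsel (hα 0) hα' hγ hm hΩ hk
  have havg := hNS.averageSNR_outputSNR hsel (hα 0) hα' hγ hm hΩ hk
  have hpdf := hNS.hasPDF_outputSNR hsel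
  refine ⟨hpdf, hint, ?_, havg, hmean, fun W' _ P' _ m' hm' N' S' hNS' sel' hsel' => ?_⟩
  · have hint_pdf := (pdf.integrable_pdf_smul_iff (X := UAVSelection.outputSNR N S sel)
      (f := fun x : ℝ => x) (measurable_id.aestronglyMeasurable (μ := volume))).2 hint
    simpa only [smul_eq_mul, mul_comm] using hint_pdf.integrableOn
  · rw [havg, hNS'.averageSNR_outputSNR hsel' (hα 0) hα' hγ hm' hΩ hk]
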